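/- \textbf{Theorem.} Let $0<p\le 2$ and put $s=\tfrac1p-\tfrac12$. There is a constant $C=C(p)<\infty$ such that the following holds. Let $N\in\mathbb N$ with $N>s$, and let $\varphi:\mathbb R\to\mathbb C$ be a compactly supported $C^N$ function whose wavelet system $\varphi_{j,n}(x)=2^{n/2}\varphi(2^nx-j)$, $j,n\in\mathbb Z$, is an orthonormal basis of $L_2(\mathbb R)$. Let $k\in L_2(\mathbb R^2)$, regarded as the $L_2(\mathbb R)$-valued function $x\mapsto k(x,\cdot)$, belong to the homogeneous Besov space $\dot B^{s}_{p,p}(\mathbb R,L_2(\mathbb R))$. Then the integral operator $$(\operatorname{Op}(k)f)(y)=\int_{\mathbb R}k(x,y)f(x)\,dx,\qquad f\in L_2(\mathbb R),$$ belongs to the Schatten class $\mathcal L_p(L_2(\mathbb R))$, and $$\|\operatorname{Op}(k)\|_p\le C\left(\|k\|_{L_2(\mathbb R^2)}+|k|_{\dot B^{s}_{p,p}(\mathbb R,L_2(\mathbb R))}\right).$$ Here, for a bounded operator $T$ on a Hilbert space, $\mu(n,T)=\inf\{\|T-R\|:\operatorname{rank}R\le n\}$ for $n\ge 0$ and $\|T\|_p=\big(\sum_{n\ge0}\mu(n,T)^p\big)^{1/p}$;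 the operator $T$ belongs to $\mathcal L_p$ if it is compact and $\|T\|_p<\infty$. For a complex Banach space $E$, an $E$-valued tempered distribution $f$ belongs to $\dot B^{s}_{p,q}(\mathbb R,E)$ if it can be written as $f=\sum_{j,n\in\mathbb Z}(c_{j,n}\varphi_{j,n}+P_{j,n})$, where $c_{j,n}\in E$, the $P_{j,n}$ are polynomials with coefficients in $E$, the series converges unconditionally in $\mathcal S'(\mathbb R,E)$ (in norm, on each Schwartz function), and $$\Big\|\Big(2^{n(s+\frac12-\frac1p)}\big\|(\|c_{j,n}\|_E)_{j\in\mathbb Z}\big\|_{\ell_p(\mathbb Z)}\Big)_{n\in\mathbb Z}\Big\|_{\ell_q(\mathbb Z)}<\infty ;$$ $|f|_{\dot B^{s}_{p,q}(\mathbb R,E)}$ is the infimum of this quantity over all such representations. For $p=2$ (so $s=0$) the same definition is used. -/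

import Mathlib

open MeasureTheory
open scoped ENNReal NNReal SchwartzMap

noncomputable section

/-! ### Singular values and Schatten classes -/

section Schatten

variable {H : Type*} [NormedAddCommGroup H] [InnerProductSpace ℂ H]

/-- The singular value `μ(n, T) = inf {‖T - R‖ : rank R ≤ n}` of a bounded operator, `n ≥ 0`. -/
def singularValue (n : ℕ) (T : H →L[ℂ] H) : ℝ≥0∞ :=
  ⨅ (R : H →L[ℂ] H) (_ : LinearMap.rank (R : H →ₗ[ℂ] H) ≤ (n : Cardinal)), ‖T - R‖ₑ

/-- The Schatten quasi-norm `‖T‖_p = (∑ₙ μ(n, T) ^ p) ^ (1 / p)`, with values in `[0, ∞]`. -/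
def schattenNorm (p : ℝ) (T : H →L[ℂ] H) : ℝ≥0∞ :=
  (∑' n : ℕ, singularValue n T ^ p) ^ (1 / p)

/-- The Schatten class: compact operators with finite Schatten quasi-norm. -/
def MemSchatten (p : ℝ) (T : H →L[ℂ] H) : Prop :=
  IsCompactOperator T ∧ schattenNorm p T < ∞

end Schatten

/-! ### Wavelets -/

/-- The wavelet system `φ_{j,k}(x) = 2 ^ (k / 2) φ(2 ^ k x - j)`: `j` is the translation index and
`k` the dilation index. -/
def waveletSystem (φ : ℝ → ℂ) (j k : ℤ) (x : ℝ) : ℂ :=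
  (((2 : ℝ) ^ ((k : ℝ) / 2) : ℝ) : ℂ) * φ ((2 : ℝ) ^ k * x - j)

/-- `φ` is an orthonormal wavelet: its wavelet system is an orthonormal basis of `L₂(ℝ)`. -/
def IsOrthonormalWavelet (φ : ℝ → ℂ) : Prop :=
  ∃ b : HilbertBasis (ℤ × ℤ) ℂ (Lp ℂ 2 (volume : Measure ℝ)),
    ∀ j k : ℤ, b (j, k) =ᵐ[volume] waveletSystem φ j k

/-- A compactly supported, `N`-times continuously differentiable orthonormal wavelet. -/
structure IsCompactWavelet (N : ℕ) (φ : ℝ → ℂ) : Prop where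
  contDiff : ContDiff ℝ N φ
  hasCompactSupport : HasCompactSupport φ
  isOrthonormalWavelet : IsOrthonormalWavelet φ

/-! ### Vector-valued homogeneous Besov spaces -/

section Besov

variable {E : Type*} [NormedAddCommGroup E] [NormedSpace ℂ E] [CompleteSpace E]

/-- The polynomial function `x ↦ ∑ₙ xⁿ aₙ` on `ℝ` with coefficients `aₙ ∈ E`. -/
def polyFun (P : ℕ →₀ E) (x : ℝ) : E :=
  P.sum fun n a => ((x : ℂ) ^ n) • a

/-- `f = ∑_{j,k} (c_{j,k} φ_{j,k} + P_{j,k})`, with convergence in `𝓢'(ℝ, E)`, whose topology is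
that of pointwise norm convergence on Schwartz functions. A locally integrable function `g` of
polynomial growth is the distribution `ψ ↦ ∫ ψ g`. -/
def IsWaveletRepresentation (φ : ℝ → ℂ) (f : 𝓢'(ℝ, E)) (c : ℤ → ℤ → E)
    (P : ℤ → ℤ → ℕ →₀ E) : Prop :=
  ∀ ψ : 𝓢(ℝ, ℂ), HasSum
    (fun i : ℤ × ℤ =>
      ∫ x : ℝ, ψ x • (waveletSystem φ i.1 i.2 x • c i.1 i.2 + polyFun (P i.1 i.2) x))
    (f ψ)

/-- The quasi-norm of a doubly indexed sequence `c` (translation index `j`, dilation index `n`):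
the `ℓ_q` quasi-norm over `n` of `2 ^ (n (s + 1/2 - 1/p)) ‖(‖c_{j,n}‖)_j‖_{ℓ_p}`. -/
def besovSeqNorm (s : ℝ) (p q : ℝ≥0∞) (c : ℤ → ℤ → E) : ℝ≥0∞ :=
  eLpNorm (fun n : ℤ => (2 : ℝ≥0∞) ^ ((n : ℝ) * (s + 1 / 2 - 1 / p.toReal)) *
    eLpNorm (fun j : ℤ => c j n) p Measure.count) q Measure.count

/-- Membership of an `E`-valued tempered distribution in the homogeneous Besov space
`Ḃ^s_{p,q}(ℝ, E)`, defined through the wavelet `φ`. -/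
def MemHomBesov (φ : ℝ → ℂ) (s : ℝ) (p q : ℝ≥0∞) (f : 𝓢'(ℝ, E)) : Prop :=
  ∃ (c : ℤ → ℤ → E) (P : ℤ → ℤ → ℕ →₀ E),
    IsWaveletRepresentation φ f c P ∧ besovSeqNorm s p q c < ∞

/-- The semi-quasi-norm of `Ḃ^s_{p,q}(ℝ, E)`: the infimum over all wavelet representations. -/
def homBesovSeminorm (φ : ℝ → ℂ) (s : ℝ) (p q : ℝ≥0∞) (f : 𝓢'(ℝ, E)) : ℝ≥0∞ :=
  ⨅ (c : ℤ → ℤ → E) (P : ℤ → ℤ → ℕ →₀ E) (_ : IsWaveletRepresentation φ f c P),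
    besovSeqNorm s p q c

end Besov

/-! ### Integral operators with square-integrable kernels -/

/-- `L₂(ℝ)`. -/
abbrev L2R : Type := Lp ℂ 2 (volume : Measure ℝ)

/-- `L₂(ℝ²)`. -/
abbrev L2R2 : Type := Lp ℂ 2 (volume : Measure (ℝ × ℝ))

theorem sq_eLpNorm_two {α : Type*} [MeasurableSpace α] (μ : Measure α) (f : α → ℂ) :
    eLpNorm f 2 μ ^ 2 = ∫⁻ a, ‖f a‖ₑ ^ 2 ∂μ := by
  have h := eLpNorm_nnreal_pow_eq_lintegral (μ := μ) (f := f) (p := 2) two_ne_zero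
  simp only [ENNReal.coe_ofNat, NNReal.coe_ofNat, ENNReal.rpow_two] at h
  exact h

/-- The function `y ↦ ∫ k(x, y) f(x) dx`. -/
def opFun (k : L2R2) (f : L2R) (y : ℝ) : ℂ := ∫ x : ℝ, k (x, y) * f x

theorem measurable_kernel_enorm (k : L2R2) : Measurable fun z : ℝ × ℝ => ‖k z‖ₑ ^ 2 :=
  ((Lp.stronglyMeasurable k).measurable.enorm).pow_const 2

theorem lintegral_kernel (k : L2R2) :
    ∫⁻ y : ℝ, ∫⁻ x : ℝ, ‖k (x, y)‖ₑ ^ 2 = ‖k‖ₑ ^ 2 := by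
  rw [Lp.enorm_def, sq_eLpNorm_two]
  exact (lintegral_prod_symm' (μ := (volume : Measure ℝ)) (ν := (volume : Measure ℝ)) _
    (measurable_kernel_enorm k)).symm

theorem memLp_slice (k : L2R2) :
    ∀ᵐ y : ℝ, MemLp (fun x : ℝ => k (x, y)) 2 volume := by
  have hfin : ∫⁻ y : ℝ, ∫⁻ x : ℝ, ‖k (x, y)‖ₑ ^ 2 ≠ ∞ := by
    rw [lintegral_kernel]
    exact ENNReal.pow_ne_top enorm_ne_top
  filter_upwards [ae_lt_top (measurable_kernel_enorm k).lintegral_prod_left' hfin] with y hy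
  refine ⟨((Lp.stronglyMeasurable k).comp_measurable
    measurable_prodMk_right).aestronglyMeasurable, ?_⟩
  rw [← sq_eLpNorm_two] at hy
  by_contra h
  rw [not_lt, top_le_iff] at h
  simp [h] at hy

theorem integrable_slice_mul (k : L2R2) (f : L2R) :
    ∀ᵐ y : ℝ, Integrable (fun x : ℝ => k (x, y) * f x) volume := by
  filter_upwards [memLp_slice k] with y hy
  exact hy.integrable_mul (Lp.memLp f)

theorem stronglyMeasurable_opFun (k : L2R2) (f : L2R) : StronglyMeasurable (opFun k f) := by
  have h : StronglyMeasurable fun z : ℝ × ℝ => k z * f z.1 :=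
    (Lp.stronglyMeasurable k).mul ((Lp.stronglyMeasurable f).comp_measurable measurable_fst)
  exact h.integral_prod_left'

theorem enorm_opFun_le (k : L2R2) (f : L2R) (y : ℝ) :
    ‖opFun k f y‖ₑ ^ 2 ≤ (∫⁻ x : ℝ, ‖k (x, y)‖ₑ ^ 2) * ‖f‖ₑ ^ 2 := by
  have hk : AEMeasurable (fun x : ℝ => ‖k (x, y)‖ₑ) volume :=
    ((Lp.stronglyMeasurable k).comp_measurable measurable_prodMk_right).measurable.enorm.aemeasurable
  have hf : AEMeasurable (fun x : ℝ => ‖f x‖ₑ) volume :=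
    (Lp.stronglyMeasurable f).measurable.enorm.aemeasurable
  have h1 : ‖opFun k f y‖ₑ ≤
      eLpNorm (fun x : ℝ => k (x, y)) 2 volume * eLpNorm f 2 volume := by
    calc ‖opFun k f y‖ₑ ≤ ∫⁻ x : ℝ, ‖k (x, y) * f x‖ₑ := enorm_integral_le_lintegral_enorm _
      _ = ∫⁻ x : ℝ, ((fun x : ℝ => ‖k (x, y)‖ₑ) * fun x : ℝ => ‖f x‖ₑ) x := by
          simp [enorm_mul]
      _ ≤ _ := ENNReal.lintegral_mul_le_Lp_mul_Lq volume Real.HolderConjugate.two_two hk hf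
      _ = _ := by
          simp [eLpNorm_eq_lintegral_rpow_enorm_toReal (p := 2) two_ne_zero ENNReal.ofNat_ne_top]
  calc ‖opFun k f y‖ₑ ^ 2
      ≤ (eLpNorm (fun x : ℝ => k (x, y)) 2 volume * eLpNorm f 2 volume) ^ 2 := by gcongr
    _ = _ := by rw [mul_pow, sq_eLpNorm_two, Lp.enorm_def]

theorem eLpNorm_opFun_le (k : L2R2) (f : L2R) :
    eLpNorm (opFun k f) 2 volume ≤ ‖k‖ₑ * ‖f‖ₑ := by
  have h : eLpNorm (opFun k f) 2 volume ^ 2 ≤ (‖k‖ₑ * ‖f‖ₑ) ^ 2 := by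
    rw [sq_eLpNorm_two, mul_pow, ← lintegral_kernel,
      ← lintegral_mul_const _ (measurable_kernel_enorm k).lintegral_prod_left']
    exact lintegral_mono fun y => enorm_opFun_le k f y
  exact (ENNReal.pow_le_pow_left_iff two_ne_zero).1 h

theorem memLp_opFun (k : L2R2) (f : L2R) : MemLp (opFun k f) 2 volume :=
  ⟨(stronglyMeasurable_opFun k f).aestronglyMeasurable,
    (eLpNorm_opFun_le k f).trans_lt (ENNReal.mul_lt_top enorm_lt_top enorm_lt_top)⟩

/-- The integral operator `Op(k) : L₂(ℝ) → L₂(ℝ)`, `(Op(k) f)(y) = ∫ k(x, y) f(x) dx`, of a kernel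
`k ∈ L₂(ℝ²)`. -/
def Op (k : L2R2) : L2R →L[ℂ] L2R :=
  LinearMap.mkContinuous
    { toFun := fun f => (memLp_opFun k f).toLp (opFun k f)
      map_add' := by
        intro f g
        rw [← MemLp.toLp_add]
        refine MemLp.toLp_congr _ _ ?_
        filter_upwards [integrable_slice_mul k f, integrable_slice_mul k g] with y hf hg
        simp only [opFun, Pi.add_apply]
        rw [← integral_add hf hg]
        refine integral_congr_ae ?_
        filter_upwards [Lp.coeFn_add f g] with x hx
        rw [hx, Pi.add_apply, mul_add]
      map_smul' := by
        intro a f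
        rw [RingHom.id_apply, ← MemLp.toLp_const_smul]
        refine MemLp.toLp_congr _ _ (Filter.Eventually.of_forall fun y => ?_)
        simp only [opFun, Pi.smul_apply]
        rw [← integral_smul]
        refine integral_congr_ae ?_
        filter_upwards [Lp.coeFn_smul a f] with x hx
        rw [hx, Pi.smul_apply, smul_eq_mul, smul_eq_mul, mul_left_comm] }
    ‖k‖
    (by
      intro f
      have h := ENNReal.toReal_mono (ENNReal.mul_ne_top enorm_ne_top enorm_ne_top)
        (eLpNorm_opFun_le k f)
      simpa [Lp.norm_toLp, ENNReal.toReal_mul] using h)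

theorem Op_apply_ae (k : L2R2) (f : L2R) :
    Op k f =ᵐ[volume] fun y : ℝ => ∫ x : ℝ, k (x, y) * f x :=
  MemLp.coeFn_toLp (memLp_opFun k f)

/-- A kernel `k ∈ L₂(ℝ²)` as the `L₂(ℝ)`-valued function `x ↦ k(x, ·)`, that is, as the
`L₂(ℝ)`-valued tempered distribution `ψ ↦ ∫ ψ(x) k(x, ·) dx`. -/
def kernelDistribution (k : L2R2) : 𝓢'(ℝ, L2R) :=
  ContinuousLinearMap.toPointwiseConvergenceCLM _ _ _ _
    ((Op k).comp (SchwartzMap.toLpCLM ℂ ℂ 2 (volume : Measure ℝ)))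

theorem kernelDistribution_apply_ae (k : L2R2) (ψ : 𝓢(ℝ, ℂ)) :
    kernelDistribution k ψ =ᵐ[volume] fun y : ℝ => ∫ x : ℝ, ψ x * k (x, y) := by
  refine (Op_apply_ae k (ψ.toLp 2 volume)).trans (Filter.Eventually.of_forall fun y => ?_)
  refine integral_congr_ae ?_
  filter_upwards [SchwartzMap.coeFn_toLp ψ 2 (volume : Measure ℝ)] with x hx
  rw [hx, mul_comm]

end

/-! Schwartz functions with vanishing moments annihilate polynomials and are dense in `L₂(ℝ)`, so
pairing a wavelet representation of `k` with them determines `Op(k)`: it maps the conjugate of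
`φ_{j,n}` to `c_{j,n}`. At `s = 1/p - 1/2` the Besov quasi-norm is the `ℓ_p` norm of the
coefficients, so everything reduces to `∑ μ(n, T)^p ≤ ∑ ‖T eᵢ‖^p` for an orthonormal basis `e` and
`p ≤ 2`. In finite dimensions, with right singular vectors `v_m`, one has
`‖T eᵢ‖² = ∑ μ_m² |⟨v_m, eᵢ⟩|²`, a convex combination of the `μ_m²`, and Jensen's inequality for
the concave function `t ↦ t^(p/2)` applies. The general case follows by truncation, since
`T ∘ P_F → T` in norm when `∑ ‖T eᵢ‖² < ∞`. -/

section SingularValues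

open InnerProductSpace Module

variable {𝕜 E F ι : Type*} [RCLike 𝕜] [NormedAddCommGroup E] [InnerProductSpace 𝕜 E]
  [FiniteDimensional 𝕜 E] [NormedAddCommGroup F] [InnerProductSpace 𝕜 F] [FiniteDimensional 𝕜 F]

/-- An orthonormal basis of right singular vectors of `A`, that is, of eigenvectors of `A* A`
ordered by decreasing singular value. -/
noncomputable def rightSingularBasis (A : E →ₗ[𝕜] F) :
    OrthonormalBasis (Fin (finrank 𝕜 E)) 𝕜 E :=
  A.isSymmetric_adjoint_comp_self.eigenvectorBasis rfl

theorem adjoint_apply_rightSingularBasis (A : E →ₗ[𝕜] F) (k : Fin (finrank 𝕜 E)) :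
    A.adjoint (A (rightSingularBasis A k)) =
      ((A.singularValues k ^ 2 : ℝ) : 𝕜) • rightSingularBasis A k := by
  rw [A.sq_singularValues_fin rfl]
  exact A.isSymmetric_adjoint_comp_self.apply_eigenvectorBasis rfl k

theorem norm_sq_apply_eq_sum_singularValues (A : E →ₗ[𝕜] F) (x : E) :
    ‖A x‖ ^ 2 = ∑ k : Fin (finrank 𝕜 E),
      A.singularValues k ^ 2 * ‖⟪rightSingularBasis A k, x⟫_𝕜‖ ^ 2 := by
  set v := rightSingularBasis A with hv
  have hcoord (k : Fin (finrank 𝕜 E)) :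
      ⟪v k, A.adjoint (A x)⟫_𝕜 = ((A.singularValues k ^ 2 : ℝ) : 𝕜) * ⟪v k, x⟫_𝕜 := by
    rw [LinearMap.adjoint_inner_right, ← LinearMap.adjoint_inner_left, hv,
      adjoint_apply_rightSingularBasis, inner_smul_left, RCLike.conj_ofReal]
  have hinner : ((‖A x‖ ^ 2 : ℝ) : 𝕜) = ⟪x, A.adjoint (A x)⟫_𝕜 := by
    rw [LinearMap.adjoint_inner_right, inner_self_eq_norm_sq_to_K, RCLike.ofReal_pow]
  rw [← RCLike.ofReal_inj (K := 𝕜), hinner, ← v.sum_inner_mul_inner, RCLike.ofReal_sum]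
  refine Finset.sum_congr rfl fun k _ => ?_
  rw [hcoord, mul_left_comm, ← inner_conj_symm x, RCLike.conj_mul]
  push_cast
  rfl

theorem exists_finrank_range_le_forall_norm_sub_le (A : E →ₗ[𝕜] F) (n : ℕ) :
    ∃ R : E →ₗ[𝕜] F, finrank 𝕜 R.range ≤ n ∧ ∀ x, ‖A x - R x‖ ≤ A.singularValues n * ‖x‖ := by
  classical
  set v := rightSingularBasis A
  let s : Finset (Fin (finrank 𝕜 E)) := {k | (k : ℕ) < n}
  let U : Submodule 𝕜 E := Submodule.span 𝕜 (s.image v : Set E)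
  refine ⟨A ∘ₗ (U.starProjection : E →ₗ[𝕜] E), ?_, fun x => ?_⟩
  · have hs : s.card ≤ n := Fin.card_filter_val_lt.trans_le (min_le_right _ _)
    calc finrank 𝕜 (A ∘ₗ (U.starProjection : E →ₗ[𝕜] E)).range
        = finrank 𝕜 (U.map A) := by rw [LinearMap.range_comp, Submodule.range_starProjection]
      _ ≤ finrank 𝕜 U := Submodule.finrank_map_le A U
      _ ≤ s.card := (finrank_span_finset_le_card _).trans Finset.card_image_le
      _ ≤ n := hs
  · set y := x - U.starProjection x
    have hy : ‖y‖ ≤ ‖x‖ := by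
      rw [show y = Uᗮ.starProjection x from (U.starProjection_orthogonal_val x).symm]
      exact Uᗮ.norm_starProjection_apply_le x
    have hcoord (k : Fin (finrank 𝕜 E)) (hk : (k : ℕ) < n) : ⟪v k, y⟫_𝕜 = 0 :=
      U.inner_right_of_mem_orthogonal
        (Submodule.subset_span (Finset.mem_image_of_mem v (by simpa [s] using hk)))
        (U.sub_starProjection_mem_orthogonal x)
    have hsq : ‖A y‖ ^ 2 ≤ (A.singularValues n * ‖y‖) ^ 2 := by
      rw [norm_sq_apply_eq_sum_singularValues, mul_pow, ← v.sum_sq_norm_inner_right,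
        Finset.mul_sum]
      refine Finset.sum_le_sum fun k _ => ?_
      rcases lt_or_ge (k : ℕ) n with hk | hk
      · rw [hcoord k hk, norm_zero, zero_pow two_ne_zero, mul_zero, mul_zero]
      · gcongr
        · exact A.singularValues_nonneg _
        · exact A.singularValues_antitone hk
    calc ‖A x - A (U.starProjection x)‖ = ‖A y‖ := by rw [map_sub]
      _ ≤ A.singularValues n * ‖y‖ :=
        le_of_sq_le_sq hsq (mul_nonneg (A.singularValues_nonneg n) (norm_nonneg y))
      _ ≤ A.singularValues n * ‖x‖ := by gcongr; exact A.singularValues_nonneg n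

theorem sum_singularValues_rpow_le [Fintype ι] (A : E →ₗ[𝕜] F) (e : OrthonormalBasis ι 𝕜 E)
    {p : ℝ} (hp0 : 0 ≤ p) (hp2 : p ≤ 2) :
    ∑ k : Fin (finrank 𝕜 E), A.singularValues k ^ p ≤ ∑ i, ‖A (e i)‖ ^ p := by
  set v := rightSingularBasis A
  have hsq {a : ℝ} (ha : 0 ≤ a) : (a ^ 2) ^ (p / 2) = a ^ p := by
    rw [← Real.rpow_natCast_mul ha]
    congr 1
    push_cast
    ring
  have jensen (i : ι) :
      ∑ k : Fin (finrank 𝕜 E), ‖⟪v k, e i⟫_𝕜‖ ^ 2 * A.singularValues k ^ p ≤ ‖A (e i)‖ ^ p := by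
    have h := (Real.concaveOn_rpow (p := p / 2) (by positivity) (by linarith)).le_map_sum
      (t := Finset.univ) (w := fun k => ‖⟪v k, e i⟫_𝕜‖ ^ 2)
      (p := fun k => A.singularValues k ^ 2) (fun k _ => by positivity)
      (by rw [v.sum_sq_norm_inner_right, e.norm_eq_one, one_pow])
      (fun k _ => Set.mem_Ici.2 (sq_nonneg _))
    simp only [smul_eq_mul, hsq (A.singularValues_nonneg _)] at h
    rw [← hsq (norm_nonneg _), norm_sq_apply_eq_sum_singularValues]
    simpa only [mul_comm] using h
  calc ∑ k : Fin (finrank 𝕜 E), A.singularValues k ^ p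
      = ∑ k : Fin (finrank 𝕜 E), (∑ i, ‖⟪v k, e i⟫_𝕜‖ ^ 2) * A.singularValues k ^ p := by
        simp only [e.sum_sq_norm_inner_left, v.norm_eq_one, one_pow, one_mul]
    _ = ∑ i, ∑ k : Fin (finrank 𝕜 E), ‖⟪v k, e i⟫_𝕜‖ ^ 2 * A.singularValues k ^ p := by
        simp only [Finset.sum_mul]
        exact Finset.sum_comm
    _ ≤ ∑ i, ‖A (e i)‖ ^ p := Finset.sum_le_sum fun i _ => jensen i

end SingularValues

section Approximation

open Module

variable {H : Type*} [NormedAddCommGroup H] [InnerProductSpace ℂ H]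

theorem singularValue_eq_infEDist (n : ℕ) (T : H →L[ℂ] H) :
    singularValue n T =
      Metric.infEDist T {R | LinearMap.rank (R : H →ₗ[ℂ] H) ≤ (n : Cardinal)} := by
  simp only [singularValue, Metric.infEDist, edist_eq_enorm_sub, Set.mem_ofPred_eq]

theorem continuous_singularValue (n : ℕ) :
    Continuous fun T : H →L[ℂ] H => singularValue n T :=
  Metric.continuous_infEDist.congr fun T => (singularValue_eq_infEDist n T).symm

theorem singularValue_comp_starProjection_le (T : H →L[ℂ] H) (U : Submodule ℂ H)
    [FiniteDimensional ℂ U] (n : ℕ) :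
    singularValue n (T ∘L U.starProjection) ≤
      ENNReal.ofReal ((T.toLinearMap.submoduleMap U).singularValues n) := by
  set A := T.toLinearMap.submoduleMap U
  obtain ⟨R, hrank, hnorm⟩ := exists_finrank_range_le_forall_norm_sub_le A n
  let S : H →L[ℂ] H :=
    (U.map T.toLinearMap).subtypeL ∘L R.toContinuousLinearMap ∘L U.orthogonalProjectionOnto
  have hS : LinearMap.rank (S : H →ₗ[ℂ] H) ≤ (n : Cardinal) := by
    have hrange : (S : H →ₗ[ℂ] H).range ≤ R.range.map (U.map T.toLinearMap).subtype := by
      rintro _ ⟨x, rfl⟩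
      exact ⟨_, ⟨U.orthogonalProjectionOnto x, rfl⟩, rfl⟩
    calc LinearMap.rank (S : H →ₗ[ℂ] H)
        ≤ Module.rank ℂ (R.range.map (U.map T.toLinearMap).subtype) := Submodule.rank_mono hrange
      _ ≤ Module.rank ℂ R.range := rank_map_le _ _
      _ = finrank ℂ R.range := (finrank_eq_rank ℂ _).symm
      _ ≤ n := by exact_mod_cast hrank
  refine (iInf₂_le S hS).trans ?_
  rw [← ofReal_norm]
  refine ENNReal.ofReal_le_ofReal
    (ContinuousLinearMap.opNorm_le_bound _ (A.singularValues_nonneg n) fun x => ?_)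
  set y := U.orthogonalProjectionOnto x
  calc ‖(T ∘L U.starProjection - S) x‖ = ‖A y - R y‖ := rfl
    _ ≤ A.singularValues n * ‖y‖ := hnorm y
    _ ≤ A.singularValues n * ‖x‖ := by
      gcongr
      · exact A.singularValues_nonneg n
      · exact U.norm_orthogonalProjectionOnto_apply_le x

theorem tsum_singularValue_comp_starProjection_rpow_le {ι : Type*} [Fintype ι] (T : H →L[ℂ] H)
    {U : Submodule ℂ H} [FiniteDimensional ℂ U] (e : OrthonormalBasis ι ℂ U) {p : ℝ}
    (hp0 : 0 < p) (hp2 : p ≤ 2) :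
    ∑' n, singularValue n (T ∘L U.starProjection) ^ p ≤ ∑ i, ‖T (e i)‖ₑ ^ p := by
  set A := T.toLinearMap.submoduleMap U
  have hA (i : ι) : ‖A (e i)‖ = ‖T (e i)‖ := rfl
  calc ∑' n, singularValue n (T ∘L U.starProjection) ^ p
      ≤ ∑' n, ENNReal.ofReal (A.singularValues n ^ p) := by
        refine ENNReal.tsum_le_tsum fun n => ?_
        rw [← ENNReal.ofReal_rpow_of_nonneg (A.singularValues_nonneg n) hp0.le]
        gcongr
        exact singularValue_comp_starProjection_le T U n
    _ = ∑ k : Fin (finrank ℂ U), ENNReal.ofReal (A.singularValues k ^ p) := by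
        rw [tsum_eq_sum (s := Finset.range (finrank ℂ U)), Finset.sum_range]
        intro n hn
        rw [A.singularValues_of_finrank_le (not_lt.1 (Finset.mem_range.not.1 hn)),
          Real.zero_rpow hp0.ne', ENNReal.ofReal_zero]
    _ = ENNReal.ofReal (∑ k : Fin (finrank ℂ U), A.singularValues k ^ p) :=
        (ENNReal.ofReal_sum_of_nonneg fun k _ =>
          Real.rpow_nonneg (A.singularValues_nonneg _) p).symm
    _ ≤ ENNReal.ofReal (∑ i, ‖A (e i)‖ ^ p) :=
        ENNReal.ofReal_le_ofReal (sum_singularValues_rpow_le A e hp0.le hp2)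
    _ = ∑ i, ‖T (e i)‖ₑ ^ p := by
        rw [ENNReal.ofReal_sum_of_nonneg fun i _ => by positivity]
        simp only [hA, ← ENNReal.ofReal_rpow_of_nonneg (norm_nonneg _) hp0.le, ofReal_norm]

end Approximation

section HilbertSchmidt

open InnerProductSpace Filter Topology

variable {𝕜 H G ι : Type*} [RCLike 𝕜] [NormedAddCommGroup H] [InnerProductSpace 𝕜 H]
  [NormedAddCommGroup G] [NormedSpace 𝕜 G]

theorem norm_le_sqrt_tsum_norm_sq_hilbertBasis (b : HilbertBasis ι 𝕜 H) (T : H →L[𝕜] G)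
    (hT : Summable fun i => ‖T (b i)‖ ^ 2) : ‖T‖ ≤ √(∑' i, ‖T (b i)‖ ^ 2) := by
  refine T.opNorm_le_bound (Real.sqrt_nonneg _) fun x => ?_
  have hsum : HasSum (fun i => ⟪b i, x⟫_𝕜 • T (b i)) (T x) := by
    simpa only [map_smul, b.repr_apply_apply] using (b.hasSum_repr x).mapL T
  refine le_of_tendsto hsum.norm (Eventually.of_forall fun s => ?_)
  calc ‖∑ i ∈ s, ⟪b i, x⟫_𝕜 • T (b i)‖
      ≤ ∑ i ∈ s, ‖⟪b i, x⟫_𝕜‖ * ‖T (b i)‖ :=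
        (norm_sum_le _ _).trans_eq (Finset.sum_congr rfl fun i _ => norm_smul _ _)
    _ ≤ √(∑ i ∈ s, ‖⟪b i, x⟫_𝕜‖ ^ 2) * √(∑ i ∈ s, ‖T (b i)‖ ^ 2) :=
        Real.sum_mul_le_sqrt_mul_sqrt _ _ _
    _ ≤ ‖x‖ * √(∑' i, ‖T (b i)‖ ^ 2) := by
        gcongr
        · exact (Real.sqrt_le_left (norm_nonneg x)).2 (b.orthonormal.sum_inner_products_le x)
        · exact hT.sum_le_tsum s fun i _ => sq_nonneg _
    _ = √(∑' i, ‖T (b i)‖ ^ 2) * ‖x‖ := mul_comm _ _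

open scoped Classical in
/-- The span of the vectors `b i`, `i ∈ F`, written as the span of a `Finset` so that
`OrthonormalBasis.span` applies to it. -/
noncomputable def partialSpan (b : HilbertBasis ι 𝕜 H) (F : Finset ι) : Submodule 𝕜 H :=
  Submodule.span 𝕜 (F.image b : Set H)

instance (b : HilbertBasis ι 𝕜 H) (F : Finset ι) : FiniteDimensional 𝕜 (partialSpan b F) :=
  FiniteDimensional.span_finset 𝕜 _

open scoped Classical in
theorem starProjection_partialSpan_apply (b : HilbertBasis ι 𝕜 H) (F : Finset ι) (i : ι) :
    (partialSpan b F).starProjection (b i) = if i ∈ F then b i else 0 := by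
  split_ifs with hi
  · exact Submodule.starProjection_eq_self_iff.2
      (Submodule.subset_span (Finset.mem_image_of_mem b hi))
  · have horth : (F.image b : Set H) ⊆ (𝕜 ∙ b i)ᗮ := by
      rintro _ hx
      obtain ⟨j, hj, rfl⟩ := Finset.mem_image.1 hx
      exact Submodule.mem_orthogonal_singleton_iff_inner_right.2
        (b.orthonormal.inner_eq_zero (ne_of_mem_of_not_mem hj hi).symm)
    exact (Submodule.starProjection_apply_eq_zero_iff _).2 fun _ hx =>
      Submodule.mem_orthogonal_singleton_iff_inner_left.1 (Submodule.span_le.2 horth hx)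

theorem tendsto_comp_starProjection_partialSpan (b : HilbertBasis ι 𝕜 H) (T : H →L[𝕜] G)
    (hT : Summable fun i => ‖T (b i)‖ ^ 2) :
    Tendsto (fun F => T ∘L (partialSpan b F).starProjection) atTop (𝓝 T) := by
  classical
  have htail (F : Finset ι) (i : ι) :
      ‖(T - T ∘L (partialSpan b F).starProjection) (b i)‖ ^ 2 =
        Set.indicator {j | j ∉ F} (fun j => ‖T (b j)‖ ^ 2) i := by
    by_cases hi : i ∈ F <;> simp [starProjection_partialSpan_apply, hi]
  have hbound (F : Finset ι) :
      ‖T - T ∘L (partialSpan b F).starProjection‖ ≤ √(∑' i : {j // j ∉ F}, ‖T (b i)‖ ^ 2) := by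
    have h := norm_le_sqrt_tsum_norm_sq_hilbertBasis b (T - T ∘L (partialSpan b F).starProjection)
      ((hT.indicator _).congr fun i => (htail F i).symm)
    rwa [tsum_congr (htail F), ← tsum_subtype {j | j ∉ F} fun i => ‖T (b i)‖ ^ 2] at h
  have hzero :
      Tendsto (fun F : Finset ι => √(∑' i : {j // j ∉ F}, ‖T (b i)‖ ^ 2)) atTop (𝓝 0) := by
    simpa using (tendsto_tsum_compl_atTop_zero fun i => ‖T (b i)‖ ^ 2).sqrt
  rw [tendsto_iff_norm_sub_tendsto_zero]
  refine squeeze_zero (fun _ => norm_nonneg _) (fun F => ?_) hzero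
  rw [norm_sub_rev]
  exact hbound F

theorem isCompactOperator_of_summable_norm_sq [CompleteSpace G] (b : HilbertBasis ι 𝕜 H)
    (T : H →L[𝕜] G) (hT : Summable fun i => ‖T (b i)‖ ^ 2) : IsCompactOperator T := by
  refine isCompactOperator_of_tendsto (tendsto_comp_starProjection_partialSpan b T hT)
    (Eventually.of_forall fun F => ?_)
  have h : IsCompactOperator (T ∘L (partialSpan b F).subtypeL) :=
    isCompactOperator_of_locallyCompactSpace_rng _
  exact h.comp_clm (partialSpan b F).orthogonalProjectionOnto

theorem summable_norm_rpow_of_tsum_enorm_rpow_ne_top {a : ι → G} {p q : ℝ} (hp : 0 < p)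
    (hpq : p ≤ q) (ha : ∑' i, ‖a i‖ₑ ^ p ≠ ∞) : Summable fun i => ‖a i‖ ^ q := by
  have hq : 0 < q := hp.trans_le hpq
  have hsum : Summable fun i => ‖a i‖ ^ p := by
    refine (ENNReal.summable_toReal ha).congr fun i => ?_
    rw [← ENNReal.toReal_rpow, toReal_enorm]
  have hmem : Memℓp (E := fun _ => G) a (ENNReal.ofReal p) :=
    memℓp_gen (by simpa only [ENNReal.toReal_ofReal hp.le] using hsum)
  have := (hmem.of_exponent_ge (ENNReal.ofReal_le_ofReal hpq)).summable
    (by rwa [ENNReal.toReal_ofReal hq.le])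
  simpa only [ENNReal.toReal_ofReal hq.le] using this

end HilbertSchmidt

section SchattenBound

open Filter

variable {H ι : Type*} [NormedAddCommGroup H] [InnerProductSpace ℂ H]

theorem tsum_singularValue_comp_starProjection_partialSpan_rpow_le (b : HilbertBasis ι ℂ H)
    (T : H →L[ℂ] H) {p : ℝ} (hp0 : 0 < p) (hp2 : p ≤ 2) (F : Finset ι) :
    ∑' n, singularValue n (T ∘L (partialSpan b F).starProjection) ^ p ≤
      ∑ i ∈ F, ‖T (b i)‖ₑ ^ p := by
  classical
  let e : OrthonormalBasis F ℂ (partialSpan b F) := OrthonormalBasis.span b.orthonormal F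
  have he (i : F) : (e i : H) = b i := OrthonormalBasis.span_apply b.orthonormal F i
  have h := tsum_singularValue_comp_starProjection_rpow_le T e hp0 hp2
  simpa only [he, Finset.sum_coe_sort F fun i => ‖T (b i)‖ₑ ^ p] using h

theorem tsum_singularValue_rpow_le (b : HilbertBasis ι ℂ H) (T : H →L[ℂ] H) {p : ℝ}
    (hp0 : 0 < p) (hp2 : p ≤ 2) :
    ∑' n, singularValue n T ^ p ≤ ∑' i, ‖T (b i)‖ₑ ^ p := by
  rcases eq_or_ne (∑' i, ‖T (b i)‖ₑ ^ p) ∞ with htop | hfin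
  · exact htop ▸ le_top
  have hT : Summable fun i => ‖T (b i)‖ ^ 2 := by
    simpa only [Real.rpow_two] using summable_norm_rpow_of_tsum_enorm_rpow_ne_top hp0 hp2 hfin
  rw [ENNReal.tsum_eq_iSup_sum]
  refine iSup_le fun s => ?_
  have hcont : Continuous fun S : H →L[ℂ] H => ∑ n ∈ s, singularValue n S ^ p :=
    continuous_finsetSum _ fun n _ =>
      ENNReal.continuous_rpow_const.comp (continuous_singularValue n)
  refine le_of_tendsto ((hcont.tendsto T).comp (tendsto_comp_starProjection_partialSpan b T hT))
    (Eventually.of_forall fun F => ?_)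
  calc ∑ n ∈ s, singularValue n (T ∘L (partialSpan b F).starProjection) ^ p
      ≤ ∑' n, singularValue n (T ∘L (partialSpan b F).starProjection) ^ p :=
        ENNReal.sum_le_tsum s
    _ ≤ ∑ i ∈ F, ‖T (b i)‖ₑ ^ p :=
        tsum_singularValue_comp_starProjection_partialSpan_rpow_le b T hp0 hp2 F
    _ ≤ ∑' i, ‖T (b i)‖ₑ ^ p := ENNReal.sum_le_tsum F

end SchattenBound

section Lizorkin

open Filter Topology FourierTransform InnerProductSpace

theorem integrable_schwartz_mul_pow (ψ : 𝓢(ℝ, ℂ)) (n : ℕ) :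
    Integrable fun x : ℝ => ψ x * (x : ℂ) ^ n := by
  refine (ψ.integrable_pow_mul volume n).mono' (by fun_prop) (Eventually.of_forall fun x => ?_)
  simp [mul_comm]

/-- The Lizorkin space of Schwartz functions all of whose moments vanish: they annihilate the
polynomial ambiguity of homogeneous Besov spaces. -/
def lizorkinSpace : Submodule ℂ 𝓢(ℝ, ℂ) where
  carrier := {ψ | ∀ n : ℕ, ∫ x : ℝ, ψ x * (x : ℂ) ^ n = 0}
  zero_mem' n := by simp
  add_mem' {ψ χ} hψ hχ n := by
    simp only [add_apply, add_mul]
    rw [integral_add (integrable_schwartz_mul_pow ψ n) (integrable_schwartz_mul_pow χ n), hψ n,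
      hχ n, add_zero]
  smul_mem' a ψ hψ n := by
    simp only [smul_apply, smul_eq_mul, mul_assoc]
    rw [integral_const_mul, hψ n, mul_zero]

theorem iteratedDeriv_fourier_zero (ψ : 𝓢(ℝ, ℂ)) (n : ℕ) :
    iteratedDeriv n (𝓕 (ψ : ℝ → ℂ)) 0 =
      (-2 * Real.pi * Complex.I) ^ n * ∫ x : ℝ, ψ x * (x : ℂ) ^ n := by
  have hint (m : ℕ) : Integrable fun x : ℝ => x ^ m • ψ x :=
    (integrable_schwartz_mul_pow ψ m).congr (Eventually.of_forall fun x => by simp [mul_comm])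
  rw [Real.iteratedDeriv_fourier (N := ⊤) (fun m _ => hint m) le_top, Real.fourier_eq,
    ← integral_const_mul]
  refine integral_congr_ae (Eventually.of_forall fun x => ?_)
  simp only [inner_zero_right, neg_zero, AddChar.map_zero_eq_one, one_smul, smul_eq_mul]
  ring

theorem mem_lizorkinSpace_of_fourier_eventuallyEq_zero {ψ : 𝓢(ℝ, ℂ)}
    (hψ : 𝓕 (ψ : ℝ → ℂ) =ᶠ[𝓝 0] 0) : ψ ∈ lizorkinSpace := by
  intro n
  have h : (-2 * Real.pi * Complex.I) ^ n * ∫ x : ℝ, ψ x * (x : ℂ) ^ n = 0 := by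
    rw [← iteratedDeriv_fourier_zero, hψ.iteratedDeriv_eq n]
    simp [Pi.zero_def]
  exact (mul_eq_zero.1 h).resolve_left (pow_ne_zero n (by simp [Real.pi_ne_zero]))

theorem ae_eq_zero_of_forall_inner_toLp_eq_zero {U : Set ℝ} (hU : IsOpen U) (v : L2R)
    (h : ∀ η : 𝓢(ℝ, ℂ), HasCompactSupport η → tsupport η ⊆ U → ⟪η.toLp 2 volume, v⟫_ℂ = 0) :
    ∀ᵐ x : ℝ, x ∈ U → v x = 0 := by
  refine hU.ae_eq_zero_of_integral_contDiff_smul_eq_zero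
    (((Lp.memLp v).locallyIntegrable (by norm_num)).locallyIntegrableOn U) fun g hg hgs hgU => ?_
  have hgs' : HasCompactSupport fun x => (g x : ℂ) := hgs.comp_left Complex.ofReal_zero
  let η : 𝓢(ℝ, ℂ) := hgs'.toSchwartzMap (Complex.ofRealCLM.contDiff.comp hg)
  have hη (x : ℝ) : η x = g x := rfl
  have hsub : tsupport η ⊆ U := (tsupport_comp_subset Complex.ofReal_zero g).trans hgU
  rw [← h η hgs' hsub, L2.inner_def]
  refine integral_congr_ae ?_
  filter_upwards [η.coeFn_toLp 2 volume] with x hx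
  rw [hx, hη]
  simp [mul_comm]

theorem orthogonal_map_toLpCLM_lizorkinSpace :
    (lizorkinSpace.map (SchwartzMap.toLpCLM ℂ ℂ 2 (volume : Measure ℝ)).toLinearMap)ᗮ = ⊥ := by
  refine (Submodule.eq_bot_iff _).2 fun u hu => ?_
  have hae : ∀ᵐ ξ : ℝ, ξ ∈ ({0}ᶜ : Set ℝ) → (𝓕 u : L2R) ξ = 0 := by
    refine ae_eq_zero_of_forall_inner_toLp_eq_zero isOpen_compl_singleton _ fun η _ hη => ?_
    have hFη : 𝓕 (𝓕⁻ η) = η := fourier_fourierInv_eq η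
    have hmem : 𝓕⁻ η ∈ lizorkinSpace := by
      refine mem_lizorkinSpace_of_fourier_eventuallyEq_zero ?_
      rw [← SchwartzMap.fourier_coe, hFη]
      exact notMem_tsupport_iff_eventuallyEq.1 fun h => hη h rfl
    rw [← hFη, ← SchwartzMap.toLp_fourier_eq, Lp.inner_fourier_eq]
    exact Submodule.inner_right_of_mem_orthogonal (Submodule.mem_map_of_mem hmem) hu
  have hzero : (𝓕 u : L2R) = 0 := by
    rw [Lp.eq_zero_iff_ae_eq_zero]
    filter_upwards [hae, Measure.ae_ne volume (0 : ℝ)] with ξ hξ hξ0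
    exact hξ hξ0
  rw [← norm_eq_zero, ← Lp.norm_fourier_eq, hzero, norm_zero]

theorem integral_smul_add_polyFun {E : Type*} [NormedAddCommGroup E] [NormedSpace ℂ E]
    [CompleteSpace E] {ψ : 𝓢(ℝ, ℂ)} (hψ : ψ ∈ lizorkinSpace) {w : ℝ → ℂ}
    (hw : Integrable fun x => ψ x * w x) (a : E) (P : ℕ →₀ E) :
    ∫ x : ℝ, ψ x • (w x • a + polyFun P x) = (∫ x, ψ x * w x) • a := by
  have hexpand (x : ℝ) : ψ x • (w x • a + polyFun P x) =
      (ψ x * w x) • a + ∑ n ∈ P.support, (ψ x * (x : ℂ) ^ n) • P n := by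
    simp only [polyFun, Finsupp.sum, smul_add, Finset.smul_sum, smul_smul]
  have hint (n : ℕ) : Integrable fun x : ℝ => (ψ x * (x : ℂ) ^ n) • P n :=
    (integrable_schwartz_mul_pow ψ n).smul_const _
  have hvanish (n : ℕ) : ∫ x : ℝ, (ψ x * (x : ℂ) ^ n) • P n = 0 := by
    rw [integral_smul_const, hψ n, zero_smul]
  simp only [hexpand]
  rw [integral_add (hw.smul_const a) (integrable_finsetSum _ fun n _ => hint n),
    integral_finsetSum _ fun n _ => hint n, integral_smul_const,
    Finset.sum_eq_zero fun n _ => hvanish n, add_zero]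

end Lizorkin

section Conjugation

open InnerProductSpace ComplexConjugate

variable {α 𝕜 ι : Type*} [RCLike 𝕜] [MeasurableSpace α] {μ : Measure α}

theorem inner_star_left (f g : Lp 𝕜 2 μ) : ⟪star f, g⟫_𝕜 = ⟪star g, f⟫_𝕜 := by
  rw [L2.inner_def, L2.inner_def]
  refine integral_congr_ae ?_
  filter_upwards [Lp.coeFn_star f, Lp.coeFn_star g] with x hf hg
  rw [hf, hg]
  simp [mul_comm]

theorem orthonormal_star {v : ι → Lp 𝕜 2 μ} (hv : Orthonormal 𝕜 v) :
    Orthonormal 𝕜 fun i => star (v i) := by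
  classical
  rw [orthonormal_iff_ite] at hv ⊢
  intro i j
  rw [inner_star_left, star_star, hv]
  simp only [eq_comm]

theorem orthogonal_span_range_star_hilbertBasis (b : HilbertBasis ι 𝕜 (Lp 𝕜 2 μ)) :
    (Submodule.span 𝕜 (Set.range fun i => star (b i)))ᗮ = ⊥ := by
  refine (Submodule.eq_bot_iff _).2 fun f hf => ?_
  have hcoord (i : ι) : b.repr (star f) i = 0 := by
    rw [b.repr_apply_apply, ← inner_conj_symm, inner_star_left,
      Submodule.inner_right_of_mem_orthogonal (Submodule.subset_span (Set.mem_range_self i)) hf,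
      map_zero]
  have hstar : star f = 0 := b.repr.map_eq_zero_iff.1 (lp.ext (funext hcoord))
  rw [← inner_self_eq_zero (𝕜 := 𝕜), ← star_star f, inner_star_left, hstar, inner_zero_right]

/-- The Hilbert basis of complex conjugates of the functions of a Hilbert basis of `L²`. -/
noncomputable def conjHilbertBasis (b : HilbertBasis ι 𝕜 (Lp 𝕜 2 μ)) :
    HilbertBasis ι 𝕜 (Lp 𝕜 2 μ) :=
  HilbertBasis.mkOfOrthogonalEqBot (orthonormal_star b.orthonormal)
    (orthogonal_span_range_star_hilbertBasis b)

theorem conjHilbertBasis_apply (b : HilbertBasis ι 𝕜 (Lp 𝕜 2 μ)) (i : ι) :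
    conjHilbertBasis b i = star (b i) :=
  congrFun (HilbertBasis.coe_mkOfOrthogonalEqBot _ _) i

end Conjugation

section Coefficients

open InnerProductSpace

theorem apply_hilbertBasis_eq_of_hasSum {𝕜 H G ι : Type*} [RCLike 𝕜] [NormedAddCommGroup H]
    [InnerProductSpace 𝕜 H] [CompleteSpace H] [NormedAddCommGroup G] [InnerProductSpace 𝕜 G]
    [CompleteSpace G] (T : H →L[𝕜] G) (e : HilbertBasis ι 𝕜 H) {c : ι → G}
    (hc : Summable fun i => ‖c i‖ ^ 2) {D : Submodule 𝕜 H} (hD : Dᗮ = ⊥)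
    (hT : ∀ d ∈ D, HasSum (fun i => ⟪e i, d⟫_𝕜 • c i) (T d)) (i : ι) : T (e i) = c i := by
  refine ext_inner_right 𝕜 fun h => ?_
  have hmem : Memℓp (E := fun _ => 𝕜) (fun i => ⟪c i, h⟫_𝕜) 2 := by
    rw [memℓp_gen_iff (by simp)]
    refine (hc.mul_right (‖h‖ ^ 2)).of_nonneg_of_le (fun i => by positivity) fun i => ?_
    rw [ENNReal.toReal_ofNat, Real.rpow_two, ← mul_pow]
    gcongr
    exact norm_inner_le_norm _ _
  let w : H := e.repr.symm ⟨_, hmem⟩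
  have hw (i : ι) : ⟪e i, w⟫_𝕜 = ⟪c i, h⟫_𝕜 := by
    rw [← e.repr_apply_apply, LinearIsometryEquiv.apply_symm_apply]
  have hinner (d : H) (hd : d ∈ D) : ⟪T d, h⟫_𝕜 = ⟪d, w⟫_𝕜 := by
    rw [← inner_conj_symm]
    refine (((hT d hd).mapL (innerSL 𝕜 h)).map (starRingEnd 𝕜) RCLike.continuous_conj).unique
      ((e.hasSum_inner_mul_inner d w).congr_fun fun i => ?_)
    simp [hw]
  have hadj : ContinuousLinearMap.adjoint T h = w := by
    refine sub_eq_zero.1 ((Submodule.eq_bot_iff _).1 hD _ fun d hd => ?_)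
    rw [inner_sub_right, ContinuousLinearMap.adjoint_inner_right, hinner d hd, sub_self]
  rw [← hw, ← hadj, ContinuousLinearMap.adjoint_inner_right]

theorem integrable_schwartz_mul (ψ : 𝓢(ℝ, ℂ)) (w : L2R) : Integrable fun x => ψ x * w x :=
  (ψ.memLp 2 volume).integrable_mul (Lp.memLp w)

theorem integral_schwartz_mul_eq_inner (ψ : 𝓢(ℝ, ℂ)) (w : L2R) :
    ∫ x, ψ x * w x = ⟪star w, ψ.toLp 2 volume⟫_ℂ := by
  rw [L2.inner_def]
  refine integral_congr_ae ?_
  filter_upwards [Lp.coeFn_star w, ψ.coeFn_toLp 2 volume] with x hw hψ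
  rw [hw, hψ]
  simp

theorem Op_conjHilbertBasis_eq {φ : ℝ → ℂ} {b : HilbertBasis (ℤ × ℤ) ℂ L2R}
    (hb : ∀ j n : ℤ, b (j, n) =ᵐ[volume] waveletSystem φ j n) {k : L2R2} {c : ℤ → ℤ → L2R}
    {P : ℤ → ℤ → ℕ →₀ L2R} (hrep : IsWaveletRepresentation φ (kernelDistribution k) c P)
    (hc : Summable fun i : ℤ × ℤ => ‖c i.1 i.2‖ ^ 2) (i : ℤ × ℤ) :
    Op k (conjHilbertBasis b i) = c i.1 i.2 := by
  refine apply_hilbertBasis_eq_of_hasSum (Op k) (conjHilbertBasis b) (c := fun i => c i.1 i.2) hc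
    orthogonal_map_toLpCLM_lizorkinSpace ?_ i
  rintro _ ⟨ψ, hψ, rfl⟩
  refine (hrep ψ).congr_fun fun i => ?_
  have hae : (fun x => ψ x * b i x) =ᵐ[volume] fun x => ψ x * waveletSystem φ i.1 i.2 x :=
    (hb i.1 i.2).mono fun x hx => congrArg (ψ x * ·) hx
  rw [integral_smul_add_polyFun hψ ((integrable_schwartz_mul ψ (b i)).congr hae),
    ← integral_congr_ae hae, integral_schwartz_mul_eq_inner, ← conjHilbertBasis_apply]
  rfl

end Coefficients

section CriticalBesov

variable {E : Type*} [NormedAddCommGroup E] {p : ℝ}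

theorem besovSeqNorm_eq_tsum (hp0 : 0 < p) (c : ℤ → ℤ → E) :
    besovSeqNorm (1 / p - 1 / 2) (ENNReal.ofReal p) (ENNReal.ofReal p) c =
      (∑' i : ℤ × ℤ, ‖c i.1 i.2‖ₑ ^ p) ^ (1 / p) := by
  have hp : ENNReal.ofReal p ≠ 0 := by simpa using hp0
  have hweight (n : ℤ) : (n : ℝ) * (1 / p - 1 / 2 + 1 / 2 - 1 / p) = 0 := by ring
  simp only [besovSeqNorm, eLpNorm_eq_lintegral_rpow_enorm_toReal hp ENNReal.ofReal_ne_top,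
    ENNReal.toReal_ofReal hp0.le, lintegral_count, enorm_eq_self, hweight, ENNReal.rpow_zero,
    one_mul, ← ENNReal.rpow_mul, one_div_mul_cancel hp0.ne', ENNReal.rpow_one]
  rw [ENNReal.tsum_prod', ENNReal.tsum_comm]

theorem summable_norm_sq_of_besovSeqNorm_lt_top (hp0 : 0 < p) (hp2 : p ≤ 2) {c : ℤ → ℤ → E}
    (hc : besovSeqNorm (1 / p - 1 / 2) (ENNReal.ofReal p) (ENNReal.ofReal p) c < ∞) :
    Summable fun i : ℤ × ℤ => ‖c i.1 i.2‖ ^ 2 := by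
  rw [besovSeqNorm_eq_tsum hp0, ENNReal.rpow_lt_top_iff_of_pos (by positivity)] at hc
  simpa only [Real.rpow_two] using summable_norm_rpow_of_tsum_enorm_rpow_ne_top hp0 hp2 hc.ne

variable {φ : ℝ → ℂ} {k : L2R2} {c : ℤ → ℤ → L2R} {P : ℤ → ℤ → ℕ →₀ L2R}

theorem isCompactOperator_Op_of_isWaveletRepresentation (hφ : IsOrthonormalWavelet φ)
    (hrep : IsWaveletRepresentation φ (kernelDistribution k) c P)
    (hc : Summable fun i : ℤ × ℤ => ‖c i.1 i.2‖ ^ 2) : IsCompactOperator (Op k) := by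
  obtain ⟨b, hb⟩ := hφ
  refine isCompactOperator_of_summable_norm_sq (conjHilbertBasis b) (Op k) ?_
  simpa only [Op_conjHilbertBasis_eq hb hrep hc] using hc

theorem schattenNorm_Op_le_besovSeqNorm (hp0 : 0 < p) (hp2 : p ≤ 2)
    (hφ : IsOrthonormalWavelet φ) (hrep : IsWaveletRepresentation φ (kernelDistribution k) c P) :
    schattenNorm p (Op k) ≤
      besovSeqNorm (1 / p - 1 / 2) (ENNReal.ofReal p) (ENNReal.ofReal p) c := by
  rcases eq_top_or_lt_top
    (besovSeqNorm (1 / p - 1 / 2) (ENNReal.ofReal p) (ENNReal.ofReal p) c) with htop | hfin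
  · exact htop ▸ le_top
  obtain ⟨b, hb⟩ := hφ
  have hOp := Op_conjHilbertBasis_eq hb hrep
    (summable_norm_sq_of_besovSeqNorm_lt_top hp0 hp2 hfin)
  have hsum : ∑' n, singularValue n (Op k) ^ p ≤ ∑' i : ℤ × ℤ, ‖c i.1 i.2‖ₑ ^ p := by
    simpa only [hOp] using tsum_singularValue_rpow_le (conjHilbertBasis b) (Op k) hp0 hp2
  rw [besovSeqNorm_eq_tsum hp0]
  exact ENNReal.rpow_le_rpow hsum (by positivity)

theorem schattenNorm_Op_le_homBesovSeminorm (hp0 : 0 < p) (hp2 : p ≤ 2)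
    (hφ : IsOrthonormalWavelet φ) (k : L2R2) :
    schattenNorm p (Op k) ≤ homBesovSeminorm φ (1 / p - 1 / 2) (ENNReal.ofReal p)
      (ENNReal.ofReal p) (kernelDistribution k) :=
  le_iInf fun _ => le_iInf₂ fun _ hrep => schattenNorm_Op_le_besovSeqNorm hp0 hp2 hφ hrep

end CriticalBesov

theorem mainTheorem1_general {p : ℝ} (hp0 : 0 < p) (hp2 : p ≤ 2) {φ : ℝ → ℂ}
    (hφ : IsOrthonormalWavelet φ) {k : L2R2}
    (hk : MemHomBesov φ (1 / p - 1 / 2) (ENNReal.ofReal p) (ENNReal.ofReal p)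
      (kernelDistribution k)) :
    MemSchatten p (Op k) ∧
      schattenNorm p (Op k) ≤ homBesovSeminorm φ (1 / p - 1 / 2) (ENNReal.ofReal p)
        (ENNReal.ofReal p) (kernelDistribution k) := by
  refine ⟨?_, schattenNorm_Op_le_homBesovSeminorm hp0 hp2 hφ k⟩
  obtain ⟨c, P, hrep, hfin⟩ := hk
  exact ⟨isCompactOperator_Op_of_isWaveletRepresentation hφ hrep
      (summable_norm_sq_of_besovSeqNorm_lt_top hp0 hp2 hfin),
    (schattenNorm_Op_le_besovSeqNorm hp0 hp2 hφ hrep).trans_lt hfin⟩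

theorem mainTheorem1 (p : ℝ) (hp0 : 0 < p) (hp2 : p ≤ 2) :
    ∃ C : ℝ≥0, ∀ (N : ℕ) (_ : |1 / p - 1 / 2| < (N : ℝ)) (φ : ℝ → ℂ) (_ : IsCompactWavelet N φ)
      (k : L2R2),
      MemHomBesov φ (1 / p - 1 / 2) (ENNReal.ofReal p) (ENNReal.ofReal p)
        (kernelDistribution k) →
      MemSchatten p (Op k) ∧
        schattenNorm p (Op k) ≤
          C * (‖k‖ₑ + homBesovSeminorm φ (1 / p - 1 / 2) (ENNReal.ofReal p) (ENNReal.ofReal p)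
            (kernelDistribution k)) := by
  refine ⟨1, fun N _ φ hφ k hk => ?_⟩
  obtain ⟨hmem, hle⟩ := mainTheorem1_general hp0 hp2 hφ.isOrthonormalWavelet hk
  rw [ENNReal.coe_one, one_mul]
  exact ⟨hmem, le_add_left hle⟩
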